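/- Let $\mathbf H^3=\mathbf C\times(0,\infty)$ be hyperbolic $3$-space in the upper half-space model, with ideal boundary the Riemann sphere $\mathbf S=\mathbf C\cup\{\infty\}$. A *nice lattice* is a group $\Gamma$ of isometries of $\mathbf H^3$ that acts freely and properly discontinuously with compact quotient; its elements extend continuously to homeomorphisms of $\mathbf S$. Let $H:\mathbf H^3\to\mathbf H^3$ be a bi-Lipschitz bijection and let $h:\mathbf S\to\mathbf S$ be a homeomorphism which extends $H$ continuously. Suppose that the pair $(H,h)$ is equivariant, that is, there are nice lattices $\Gamma_1,\Gamma_2$ such that $H\Gamma_1H^{-1}=\Gamma_2$ on $\mathbf H^3$ and $h\Gamma_1h^{-1}=\Gamma_2$ on $\mathbf S$. Suppose also that $h(\infty)=\infty$, so that $h$ restricts to a homeomorphism of $\mathbf C=\mathbf R^2$. For $z\in\mathbf C$ write $$\frac{\partial h}{\partial x}(z)=\lim_{t\to 0,\ t\in\mathbf R}\frac{h(z+t)-h(z)}{t}$$ when this limit exists in $\mathbf C$. Then the set of points of $[0,1]^2$ where $\partial h/\partial x$ does not exist is null (has Lebesgue measure zero), and the set of points of $[0,1]^2$ where $\partial h/\partial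 x$ exists and is nonzero is fat (is not null, that is, has positive Lebesgue outer measure). -/

import Mathlib

open Filter Topology MeasureTheory

noncomputable section

/-- Hyperbolic 3-space in the upper half-space model: pairs `(z, t)` with `z ∈ ℂ`, `t > 0`. -/
@[ext]
structure H3 where
  z : ℂ
  t : ℝ
  t_pos : 0 < t

namespace H3

/-- The point `(z, t)` in the Euclidean space `ℂ × ℝ` (with the `L²` norm). -/
def toEuclidean (p : H3) : WithLp 2 (ℂ × ℝ) := WithLp.toLp 2 (p.z, p.t)

/-- The mirror image `(z, -t)` of the point `(z, t)`; only used in the triangle inequality. -/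
def mirror (p : H3) : WithLp 2 (ℂ × ℝ) := WithLp.toLp 2 (p.z, -p.t)

/-- The hyperbolic distance: `sinh (d(p,q)/2) = |p - q| / (2 √(p.t * q.t))`, where `|p - q|` is the
Euclidean distance, equivalently `cosh d(p,q) = 1 + |p - q|² / (2 p.t q.t)`. -/
instance : Dist H3 :=
  ⟨fun p q => 2 * Real.arsinh
    (√(‖p.z - q.z‖ ^ 2 + (p.t - q.t) ^ 2) / (2 * √(p.t * q.t)))⟩

theorem dist_def (p q : H3) : dist p q = 2 * Real.arsinh
    (√(‖p.z - q.z‖ ^ 2 + (p.t - q.t) ^ 2) / (2 * √(p.t * q.t))) := rfl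

theorem dist_toEuclidean (p q : H3) :
    dist p.toEuclidean q.toEuclidean = √(‖p.z - q.z‖ ^ 2 + (p.t - q.t) ^ 2) := by
  rw [WithLp.prod_dist_eq_of_L2]
  simp [toEuclidean, dist_eq_norm]

theorem dist_mirror (p q : H3) :
    dist p.toEuclidean q.mirror = √(‖p.z - q.z‖ ^ 2 + (p.t + q.t) ^ 2) := by
  rw [WithLp.prod_dist_eq_of_L2]
  simp [toEuclidean, mirror, dist_eq_norm]

theorem sinh_half_dist (p q : H3) : Real.sinh (dist p q / 2) =
    dist p.toEuclidean q.toEuclidean / (2 * √(p.t * q.t)) := by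
  rw [dist_toEuclidean, dist_def, mul_div_cancel_left₀ _ two_ne_zero, Real.sinh_arsinh]

theorem cosh_half_dist (p q : H3) : Real.cosh (dist p q / 2) =
    dist p.toEuclidean q.mirror / (2 * √(p.t * q.t)) := by
  have hp := p.t_pos
  have hq := q.t_pos
  rw [← sq_eq_sq₀ (Real.cosh_pos _).le (by positivity), Real.cosh_sq', sinh_half_dist,
    dist_toEuclidean, dist_mirror, div_pow, div_pow, mul_pow, Real.sq_sqrt (by positivity),
    Real.sq_sqrt (by positivity), Real.sq_sqrt (by positivity)]
  field_simp
  ring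

theorem dist_symm (p q : H3) : dist p q = dist q p := by
  simp only [dist_def, norm_sub_rev p.z q.z, mul_comm p.t q.t, ← neg_sub q.t p.t, neg_sq]

theorem dist_tri (a b c : H3) : dist a c ≤ dist a b + dist b c := by
  have ha := a.t_pos
  have hb := b.t_pos
  have hc := c.t_pos
  have key := EuclideanGeometry.mul_dist_le_mul_dist_add_mul_dist
    a.toEuclidean b.toEuclidean c.toEuclidean b.mirror
  have hbb : dist b.toEuclidean b.mirror = 2 * b.t := by
    rw [dist_mirror, sub_self, norm_zero, show (0 : ℝ) ^ 2 + (b.t + b.t) ^ 2 = (2 * b.t) ^ 2 by ring,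
      Real.sqrt_sq (by positivity)]
  have hm : dist b.toEuclidean c.mirror = dist c.toEuclidean b.mirror := by
    rw [dist_mirror, dist_mirror, norm_sub_rev, add_comm b.t]
  rw [hbb] at key
  have h : Real.sinh (dist a c / 2) ≤ Real.sinh ((dist a b + dist b c) / 2) := by
    rw [add_div, Real.sinh_add]
    simp only [sinh_half_dist, cosh_half_dist, hm]
    rw [Real.sqrt_mul ha.le, Real.sqrt_mul ha.le, Real.sqrt_mul hb.le]
    have hb' : √b.t * √b.t = b.t := Real.mul_self_sqrt hb.le
    have ha0 := Real.sqrt_pos.2 ha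
    have hb0 := Real.sqrt_pos.2 hb
    have hc0 := Real.sqrt_pos.2 hc
    have e : dist a.toEuclidean c.toEuclidean / (2 * (√a.t * √c.t)) =
        dist a.toEuclidean c.toEuclidean * (2 * b.t) / (4 * b.t * (√a.t * √c.t)) := by
      field_simp
      ring
    rw [e, div_mul_div_comm, div_mul_div_comm,
      show 2 * (√a.t * √b.t) * (2 * (√b.t * √c.t)) = 4 * b.t * (√a.t * √c.t) by
        linear_combination (4 * √a.t * √c.t) * hb', ← add_div]
    gcongr
    linarith
  rw [Real.sinh_le_sinh] at h
  linarith

instance : MetricSpace H3 where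
  dist_self p := by simp [dist_def]
  dist_comm := dist_symm
  dist_triangle := dist_tri
  eq_of_dist_eq_zero {p q} h := by
    have hp := p.t_pos
    have hq := q.t_pos
    have h1 := sinh_half_dist p q
    rw [h, zero_div, Real.sinh_zero, eq_comm, div_eq_zero_iff] at h1
    rcases h1 with h1 | h1
    · have h2 : p.toEuclidean = q.toEuclidean := dist_eq_zero.1 h1
      have h3 : (p.z, p.t) = (q.z, q.t) := (WithLp.equiv 2 (ℂ × ℝ)).symm.injective h2
      exact H3.ext (congrArg Prod.fst h3) (congrArg Prod.snd h3)
    · have : 0 < 2 * √(p.t * q.t) := by positivity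
      exact absurd h1 this.ne'

/-- The closed upper half-space together with `∞` is a subset of the one-point compactification of
`ℂ × ℝ`; this is the inclusion of its interior. -/
def toBall (p : H3) : OnePoint (ℂ × ℝ) := ((p.z, p.t) : ℂ × ℝ)

end H3

/-- The Riemann sphere `ℂ ∪ {∞}`. -/
abbrev RiemannSphere : Type := OnePoint ℂ

/-- The Riemann sphere as the ideal boundary `(ℂ × {0}) ∪ {∞}` of hyperbolic space. -/
def RiemannSphere.toBall : RiemannSphere → OnePoint (ℂ × ℝ) := OnePoint.map fun z => (z, 0)

/-- A bi-Lipschitz map between metric spaces (bijectivity is part of the definition). -/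
def IsBL {X Y : Type*} [MetricSpace X] [MetricSpace Y] (f : X → Y) : Prop :=
  Function.Bijective f ∧ ∃ K : ℝ, 1 ≤ K ∧
    ∀ x y, K⁻¹ * dist x y ≤ dist (f x) (f y) ∧ dist (f x) (f y) ≤ K * dist x y

/-- A nice lattice: a group of isometries of hyperbolic space that acts freely and properly
discontinuously (so that the quotient is a manifold with universal covering space `H3` and deck
group `Γ`), with compact quotient. -/
structure IsNiceLattice (Γ : Subgroup (Equiv.Perm H3)) : Prop where
  isometry : ∀ γ ∈ Γ, Isometry γ
  free : ∀ γ ∈ Γ, ∀ p : H3, γ p = p → γ = 1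
  properlyDiscontinuous : ProperlyDiscontinuousSMul Γ H3
  compact_quotient : CompactSpace (MulAction.orbitRel.Quotient Γ H3)

/-- `h` extends `H` continuously to the Riemann sphere: `H p → h ξ` as `p ∈ H3` tends to the ideal
point `ξ`. -/
def IsBoundaryExtension (H : H3 → H3) (h : RiemannSphere → RiemannSphere) : Prop :=
  ∀ ξ : RiemannSphere,
    Tendsto (fun p => (H p).toBall) (comap H3.toBall (𝓝 ξ.toBall)) (𝓝 (h ξ).toBall)

/-- The homeomorphisms by which the elements of `Γ` act on the Riemann sphere. -/
def boundaryAction (Γ : Subgroup (Equiv.Perm H3)) : Set (RiemannSphere ≃ₜ RiemannSphere) :=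
  {k | ∃ γ ∈ Γ, IsBoundaryExtension γ k}

/-- `H` is a bi-Lipschitz map of hyperbolic space, the homeomorphism `h` of the Riemann sphere is
its continuous extension, and there are nice lattices `Γ₁`, `Γ₂` with `H Γ₁ H⁻¹ = Γ₂` on
hyperbolic space and `h Γ₁ h⁻¹ = Γ₂` on the Riemann sphere. -/
def IsEquivariantPair (H : Equiv.Perm H3) (h : RiemannSphere ≃ₜ RiemannSphere) : Prop :=
  IsBL H ∧ IsBoundaryExtension H h ∧
    ∃ Γ₁ Γ₂ : Subgroup (Equiv.Perm H3), IsNiceLattice Γ₁ ∧ IsNiceLattice Γ₂ ∧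
      (fun γ => H * γ * H⁻¹) '' (Γ₁ : Set (Equiv.Perm H3)) = Γ₂ ∧
      (fun k => h * k * h⁻¹) '' boundaryAction Γ₁ = boundaryAction Γ₂

/-- The unit square `[0,1]²` in the plane `ℂ`. -/
def unitSquare : Set ℂ := Set.Icc 0 1 ×ℂ Set.Icc 0 1

end

/-!
Isometries of hyperbolic space act by conformal maps of the Euclidean half-space, and the half-space
is conformal to the ball model, so Euclidean cross-ratios do not depend on the model and are
invariant under the lattices. Equivariance and cocompactness therefore renormalise a configuration
of points at any place and any scale to one in bounded position, where the map is the restriction of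
one fixed homeomorphism between compact closed balls, hence uniformly continuous with a uniformly
continuous inverse. This makes `h` weakly quasisymmetric on `ℂ`.

Gehring's length–area argument does the rest. By quasisymmetry the image of a disc contains a round
disc of radius comparable to the distance between the images of the end points of the horizontal
diameter. By Cauchy–Schwarz over chains of discs along a horizontal segment, the total variation is
controlled by the area of the image of a thin strip, which is linear in the width of the strip for
almost every height, by Lebesgue differentiation. Hence `h` is absolutely continuous on almost every
horizontal line, so `∂h/∂x` exists almost everywhere. If it vanished almost everywhere on an open
set, `h` would be constant on a horizontal segment, against injectivity.
-/

/-- The cross-ratio of four points of a metric space. -/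
noncomputable def crossRatio {M : Type*} [Dist M] (p q r s : M) : ℝ :=
  dist p q * dist r s / (dist r q * dist p s)

section CrossRatio

variable {X M N : Type*}

theorem crossRatio_eq_of_conformal [Dist M] [Dist N] {e : X → M} {e' : X → N} {ω : X → ℝ}
    (hω : ∀ x, ω x ≠ 0) (h : ∀ x y, dist (e x) (e y) = ω x * ω y * dist (e' x) (e' y))
    (p q r s : X) :
    crossRatio (e p) (e q) (e r) (e s) = crossRatio (e' p) (e' q) (e' r) (e' s) := by
  have hne : ω p * ω q * ω r * ω s ≠ 0 := by simp [hω]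
  simp only [crossRatio, h]
  rw [← mul_div_mul_left _ (dist (e' r) (e' q) * dist (e' p) (e' s)) hne]
  ring_nf

theorem crossRatio_le_inv [PseudoMetricSpace M] {κ : ℝ} (hκ : 0 < κ) {p q r s : M}
    (hpq : dist p q ≤ 1) (hrs : dist r s ≤ 1) (hrq : κ ≤ dist r q) (hps : κ ≤ dist p s) :
    crossRatio p q r s ≤ (κ * κ)⁻¹ := by
  rw [crossRatio, ← one_div]
  gcongr
  exact mul_le_one₀ hpq dist_nonneg hrs

variable [PseudoMetricSpace M] {l : Filter X} {p q r s : X → M} {P Q R : M}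

theorem tendsto_dist_atTop_of_tendsto (hp : Tendsto p l (𝓝 P))
    (hs : Tendsto (fun x => dist (s x) P) l atTop) :
    Tendsto (fun x => dist (p x) (s x)) l atTop := by
  refine tendsto_atTop_mono (fun x => ?_)
    (hs.atTop_add (hp.dist (tendsto_const_nhds (x := P))).neg)
  linarith [dist_triangle_left (s x) P (p x)]

theorem tendsto_dist_div_dist_one (hp : Tendsto p l (𝓝 P)) (hr : Tendsto r l (𝓝 R))
    (hs : Tendsto (fun x => dist (s x) P) l atTop) :
    Tendsto (fun x => dist (r x) (s x) / dist (p x) (s x)) l (𝓝 1) := by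
  have hps := tendsto_dist_atTop_of_tendsto hp hs
  rw [tendsto_iff_dist_tendsto_zero]
  refine squeeze_zero' (Eventually.of_forall fun x => dist_nonneg) ?_ ((hr.dist hp).div_atTop hps)
  filter_upwards [hps.eventually_gt_atTop 0] with x hx
  rw [Real.dist_eq, div_sub_one hx.ne', abs_div, abs_of_pos hx]
  gcongr
  exact abs_dist_sub_le _ _ _

theorem tendsto_crossRatio (hp : Tendsto p l (𝓝 P)) (hq : Tendsto q l (𝓝 Q))
    (hr : Tendsto r l (𝓝 R)) (hs : Tendsto (fun x => dist (s x) P) l atTop)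
    (hRQ : dist R Q ≠ 0) :
    Tendsto (fun x => crossRatio (p x) (q x) (r x) (s x)) l (𝓝 (dist P Q / dist R Q)) := by
  simpa only [crossRatio, mul_div_mul_comm, mul_one, Pi.div_apply] using
    ((hp.dist hq).div (hr.dist hq) hRQ).mul (tendsto_dist_div_dist_one hp hr hs)

end CrossRatio

theorem exists_pos_le_dist_of_ultrafilter_tendsto {X B M N : Type*} [PseudoMetricSpace M]
    [MetricSpace N] {e : X → M} {e' : X → N} {a : B → M} {b : B → N} (hb : Function.Injective b)
    (hlim : ∀ U : Ultrafilter X, ∃ ξ, Tendsto e U (𝓝 (a ξ)) ∧ Tendsto e' U (𝓝 (b ξ)))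
    {κ : ℝ} (hκ : 0 < κ) :
    ∃ κ' > 0, ∀ x y, κ ≤ dist (e x) (e y) → κ' ≤ dist (e' x) (e' y) := by
  by_contra! hc
  choose x y hxy hxy' using fun n : ℕ => hc (1 / ((n : ℝ) + 1)) (by positivity)
  obtain ⟨U, hU⟩ := Ultrafilter.exists_le (atTop : Filter ℕ)
  obtain ⟨ξ, hξ, hξ'⟩ := hlim (U.map x)
  obtain ⟨η, hη, hη'⟩ := hlim (U.map y)
  rw [Ultrafilter.coe_map, tendsto_map'_iff] at hξ hξ' hη hη'
  have hle : dist (b ξ) (b η) ≤ 0 := le_of_tendsto_of_tendsto' (hξ'.dist hη')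
    (tendsto_one_div_add_atTop_nhds_zero_nat.mono_left hU) fun n => (hxy' n).le
  have hge : κ ≤ dist (a ξ) (a η) := ge_of_tendsto' (hξ.dist hη) hxy
  rw [hb (dist_le_zero.1 hle), dist_self] at hge
  exact hκ.not_ge hge

namespace H3

section Similarities

/-- The action on hyperbolic space of the similarity `z ↦ a z + c` of the plane. -/
def similarity (a : ℝ) (ha : 0 < a) (c : ℂ) (p : H3) : H3 :=
  ⟨a * p.z + c, a * p.t, mul_pos ha p.t_pos⟩

theorem isometry_similarity {a : ℝ} (ha : 0 < a) (c : ℂ) : Isometry (similarity a ha c) := by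
  refine Isometry.of_dist_eq fun p q => ?_
  have hnum : √(‖(a : ℂ) * p.z + c - (a * q.z + c)‖ ^ 2 + (a * p.t - a * q.t) ^ 2) =
      a * √(‖p.z - q.z‖ ^ 2 + (p.t - q.t) ^ 2) := by
    rw [add_sub_add_right_eq_sub, ← mul_sub, ← mul_sub, norm_mul, mul_pow, mul_pow,
      Complex.norm_real, Real.norm_of_nonneg ha.le, ← mul_add, Real.sqrt_mul (by positivity),
      Real.sqrt_sq ha.le]
  have hden : √(a * p.t * (a * q.t)) = a * √(p.t * q.t) := by
    rw [mul_mul_mul_comm, Real.sqrt_mul (by positivity), Real.sqrt_mul_self ha.le]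
  simp only [dist_def, similarity, hnum, hden, mul_left_comm 2 a, mul_div_mul_left _ _ ha.ne']

/-- The unit speed geodesic from the ideal point `z` to `∞`. -/
noncomputable def verticalGeodesic (z : ℂ) (s : ℝ) : H3 := ⟨z, Real.exp s, Real.exp_pos s⟩

theorem similarity_verticalGeodesic {a : ℝ} (ha : 0 < a) (c z : ℂ) (s : ℝ) :
    similarity a ha c (verticalGeodesic z s) = verticalGeodesic (a * z + c) (s + Real.log a) := by
  ext
  · rfl
  · simp [similarity, verticalGeodesic, Real.exp_add, Real.exp_log ha, mul_comm]

theorem tendsto_verticalGeodesic_atBot (z : ℂ) :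
    Tendsto (fun s => (verticalGeodesic z s).toBall) atBot (𝓝 (RiemannSphere.toBall z)) :=
  (OnePoint.continuous_coe.tendsto _).comp (tendsto_const_nhds.prodMk_nhds Real.tendsto_exp_atBot)

theorem tendsto_verticalGeodesic_atTop (z : ℂ) :
    Tendsto (fun s => (verticalGeodesic z s).toBall) atTop
      (𝓝 (RiemannSphere.toBall OnePoint.infty)) := by
  have hcocompact : Tendsto (fun s => (z, Real.exp s)) atTop (coclosedCompact (ℂ × ℝ)) := by
    rw [coclosedCompact_eq_cocompact]
    refine tendsto_cocompact_of_tendsto_dist_comp_atTop 0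
      (tendsto_atTop_mono (fun s => ?_) Real.tendsto_exp_atTop)
    rw [dist_zero_right]
    exact (le_abs_self _).trans (norm_snd_le (z, Real.exp s))
  rwa [← OnePoint.comap_coe_nhds_infty, tendsto_comap_iff] at hcocompact

end Similarities

section Conformality

theorem dist_toEuclidean_map_of_isometry {g : H3 → H3} (hg : Isometry g) (p q : H3) :
    dist (g p).toEuclidean (g q).toEuclidean =
      √((g p).t / p.t) * √((g q).t / q.t) * dist p.toEuclidean q.toEuclidean := by
  have hp := p.t_pos
  have hq := q.t_pos
  have hgp := (g p).t_pos
  have hgq := (g q).t_pos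
  have h := sinh_half_dist (g p) (g q)
  rw [hg.dist_eq, sinh_half_dist, div_eq_div_iff (by positivity) (by positivity),
    Real.sqrt_mul hp.le, Real.sqrt_mul hgp.le] at h
  rw [Real.sqrt_div' _ hp.le, Real.sqrt_div' _ hq.le]
  field_simp
  linarith

theorem crossRatio_toEuclidean_map_of_isometry {g : H3 → H3} (hg : Isometry g) (p q r s : H3) :
    crossRatio (g p).toEuclidean (g q).toEuclidean (g r).toEuclidean (g s).toEuclidean =
      crossRatio p.toEuclidean q.toEuclidean r.toEuclidean s.toEuclidean :=
  crossRatio_eq_of_conformal (e := fun x => (g x).toEuclidean) (ω := fun x => √((g x).t / x.t))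
    (fun x => (Real.sqrt_pos.2 (div_pos (g x).t_pos x.t_pos)).ne')
    (dist_toEuclidean_map_of_isometry hg) p q r s

end Conformality

section BallModel

/-- The point `(0, 1)`, the centre of the ball model. -/
def base : H3 := ⟨0, 1, one_pos⟩

/-- The ball model of the closed upper half-space: the inversion in the unit sphere around the
mirror image `(0, -1)` of `base`, which is the image of `∞`. It maps the half-space to a ball of
diameter `1`. -/
noncomputable def ballChart (x : OnePoint (ℂ × ℝ)) : WithLp 2 (ℂ × ℝ) :=
  x.elim base.mirror fun v => EuclideanGeometry.inversion base.mirror 1 (WithLp.toLp 2 v)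

/-- The point of the ball model which corresponds to a point of the upper half-space. -/
noncomputable def toUnitBall (p : H3) : WithLp 2 (ℂ × ℝ) := ballChart p.toBall

theorem toLp_ne_mirror_base {v : ℂ × ℝ} (hv : v ≠ (0, -1)) : WithLp.toLp 2 v ≠ base.mirror :=
  fun h => hv ((WithLp.toLp_injective 2) h)

theorem tendsto_dist_toLp_cocompact (c : WithLp 2 (ℂ × ℝ)) :
    Tendsto (fun v : ℂ × ℝ => dist (WithLp.toLp 2 v) c) (cocompact (ℂ × ℝ)) atTop :=
  (tendsto_dist_right_cocompact_atTop c).comp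
    (WithLp.homeomorphProd 2 ℂ ℝ).symm.isClosedEmbedding.tendsto_cocompact

theorem continuousAt_ballChart {x : OnePoint (ℂ × ℝ)} (hx : x ≠ ((0, -1) : ℂ × ℝ)) :
    ContinuousAt ballChart x := by
  induction x using OnePoint.rec with
  | infty =>
    rw [OnePoint.continuousAt_infty', coclosedCompact_eq_cocompact, tendsto_iff_dist_tendsto_zero]
    refine ((tendsto_dist_toLp_cocompact base.mirror).const_div_atTop (1 ^ 2)).congr fun v => ?_
    exact (EuclideanGeometry.dist_inversion_center _ _ _).symm
  | coe v =>
    rw [OnePoint.continuousAt_coe]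
    exact tendsto_const_nhds.inversion tendsto_const_nhds
      ((WithLp.prod_continuous_toLp 2 ℂ ℝ).tendsto v)
      (toLp_ne_mirror_base fun h => hx (congrArg _ h))

theorem injOn_ballChart : Set.InjOn ballChart {x | x ≠ ((0, -1) : ℂ × ℝ)} := by
  have hinj := (EuclideanGeometry.inversion_injective base.mirror one_ne_zero).comp
    (WithLp.toLp_injective 2 (V := ℂ × ℝ))
  have hpole {v : ℂ × ℝ} (hv : (v : OnePoint (ℂ × ℝ)) ≠ ((0, -1) : ℂ × ℝ)) :
      ballChart v ≠ ballChart OnePoint.infty := fun h =>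
    hv (congrArg _ (hinj (h.trans (EuclideanGeometry.inversion_self _ _).symm)))
  intro x hx y hy h
  induction x using OnePoint.rec with
  | infty =>
    induction y using OnePoint.rec with
    | infty => rfl
    | coe w => exact absurd h.symm (hpole hy)
  | coe v =>
    induction y using OnePoint.rec with
    | infty => exact absurd h (hpole hx)
    | coe w => exact congrArg _ (hinj h)

theorem dist_ballChart_coe {v w : ℂ × ℝ} (hv : v ≠ (0, -1)) (hw : w ≠ (0, -1)) :
    dist (ballChart v) (ballChart w) = dist (WithLp.toLp 2 v) (WithLp.toLp 2 w) /
      (dist (WithLp.toLp 2 v) base.mirror * dist (WithLp.toLp 2 w) base.mirror) := by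
  refine (EuclideanGeometry.dist_inversion_inversion (toLp_ne_mirror_base hv)
    (toLp_ne_mirror_base hw) 1).trans ?_
  rw [one_pow, one_div_mul_eq_div]

theorem dist_toLp_mk_zero (z w : ℂ) :
    dist (WithLp.toLp 2 (z, (0 : ℝ))) (WithLp.toLp 2 (w, (0 : ℝ))) = dist z w := by
  simp

theorem dist_toLp_mk_zero_mirror_base (z : ℂ) :
    dist (WithLp.toLp 2 (z, (0 : ℝ))) base.mirror = √(‖z‖ ^ 2 + 1) := by
  rw [WithLp.prod_dist_eq_of_L2]
  simp [mirror, base]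

theorem dist_ballChart_toBall_coe (z w : ℂ) :
    dist (ballChart (RiemannSphere.toBall z)) (ballChart (RiemannSphere.toBall w)) =
      dist z w / (√(‖z‖ ^ 2 + 1) * √(‖w‖ ^ 2 + 1)) := by
  rw [← dist_toLp_mk_zero z w, ← dist_toLp_mk_zero_mirror_base, ← dist_toLp_mk_zero_mirror_base]
  exact dist_ballChart_coe (by simp) (by simp)

theorem dist_ballChart_toBall_infty (z : ℂ) :
    dist (ballChart (RiemannSphere.toBall z)) (ballChart (RiemannSphere.toBall OnePoint.infty)) =
      1 / √(‖z‖ ^ 2 + 1) := by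
  rw [← dist_toLp_mk_zero_mirror_base]
  exact (EuclideanGeometry.dist_inversion_center _ _ _).trans (by rw [one_pow])

theorem dist_toUnitBall (p q : H3) : dist p.toUnitBall q.toUnitBall =
    dist p.toEuclidean q.toEuclidean /
      (dist p.toEuclidean base.mirror * dist q.toEuclidean base.mirror) :=
  have hne (p : H3) : (p.z, p.t) ≠ (0, -1) := fun h => by
    linarith [p.t_pos, congrArg Prod.snd h]
  dist_ballChart_coe (hne p) (hne q)

theorem crossRatio_toUnitBall (p q r s : H3) :
    crossRatio p.toUnitBall q.toUnitBall r.toUnitBall s.toUnitBall =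
      crossRatio p.toEuclidean q.toEuclidean r.toEuclidean s.toEuclidean := by
  refine crossRatio_eq_of_conformal (e' := toEuclidean)
    (ω := fun p => (dist p.toEuclidean base.mirror)⁻¹) (fun p => ?_) (fun p q => ?_) p q r s
  · rw [dist_mirror]
    have := p.t_pos
    have := base.t_pos
    positivity
  · rw [dist_toUnitBall, div_eq_mul_inv, mul_inv, mul_comm]

theorem sinh_half_dist_eq_dist_toUnitBall (p q : H3) : Real.sinh (dist p q / 2) =
    2 * dist p.toUnitBall q.toUnitBall *
      (Real.cosh (dist p base / 2) * Real.cosh (dist q base / 2)) := by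
  have hp := p.t_pos
  have hq := q.t_pos
  have hb : base.t = 1 := rfl
  have hpb : 0 < dist p.toEuclidean base.mirror := by rw [dist_mirror, hb]; positivity
  have hqb : 0 < dist q.toEuclidean base.mirror := by rw [dist_mirror, hb]; positivity
  rw [dist_toUnitBall, sinh_half_dist, cosh_half_dist, cosh_half_dist, hb, mul_one, mul_one,
    Real.sqrt_mul hp.le]
  field_simp

theorem dist_toUnitBall_le_one (p q : H3) : dist p.toUnitBall q.toUnitBall ≤ 1 := by
  have hp := Real.sinh_lt_cosh (dist p base / 2)
  have hq := Real.sinh_lt_cosh (dist q base / 2)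
  have hp0 := Real.cosh_pos (dist p base / 2)
  have hq0 := Real.cosh_pos (dist q base / 2)
  have hadd : Real.sinh (dist p q / 2) ≤ Real.sinh (dist p base / 2 + dist q base / 2) := by
    rw [Real.sinh_le_sinh]
    linarith [dist_triangle_right p q base]
  have hsinh : Real.sinh (dist p q / 2) ≤
      2 * (Real.cosh (dist p base / 2) * Real.cosh (dist q base / 2)) := by
    rw [Real.sinh_add] at hadd
    nlinarith
  rw [sinh_half_dist_eq_dist_toUnitBall, mul_assoc] at hsinh
  have := le_of_mul_le_mul_left hsinh two_pos
  exact (mul_le_iff_le_one_left (mul_pos hp0 hq0)).1 this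

theorem dist_toUnitBall_le_sinh (p q : H3) :
    dist p.toUnitBall q.toUnitBall ≤ Real.sinh (dist p q / 2) := by
  rw [sinh_half_dist_eq_dist_toUnitBall]
  nlinarith [dist_nonneg (x := p.toUnitBall) (y := q.toUnitBall),
    one_le_mul_of_one_le_of_one_le (Real.one_le_cosh (dist p base / 2))
      (Real.one_le_cosh (dist q base / 2))]

theorem continuous_toUnitBall : Continuous toUnitBall := by
  refine continuous_iff_continuousAt.2 fun p => tendsto_iff_dist_tendsto_zero.2
    (squeeze_zero (fun _ => dist_nonneg) (fun q => dist_toUnitBall_le_sinh q p) ?_)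
  have hcont : Continuous fun q => Real.sinh (dist q p / 2) :=
    Real.continuous_sinh.comp ((continuous_id.dist continuous_const).div_const 2)
  simpa using hcont.tendsto p

theorem cosh_half_dist_map_le {g : H3 → H3} (hg : Isometry g) (p : H3) :
    Real.cosh (dist (g p) base / 2) ≤
      Real.exp (dist (g base) base / 2) * Real.cosh (dist p base / 2) := by
  have hle := dist_triangle (g p) (g base) base
  have hge := dist_triangle_right (g p) (g base) base
  rw [hg.dist_eq] at hle hge
  have hexp : Real.exp (dist (g p) base / 2) ≤
      Real.exp (dist (g base) base / 2) * Real.exp (dist p base / 2) := by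
    rw [← Real.exp_add, Real.exp_le_exp]
    linarith
  have hexp_neg : Real.exp (-(dist (g p) base / 2)) ≤
      Real.exp (dist (g base) base / 2) * Real.exp (-(dist p base / 2)) := by
    rw [← Real.exp_add, Real.exp_le_exp]
    linarith [dist_comm (g base) base]
  rw [Real.cosh_eq, Real.cosh_eq]
  linarith

theorem dist_toUnitBall_le_of_isometry {g : H3 → H3} (hg : Isometry g) (p q : H3) :
    dist p.toUnitBall q.toUnitBall ≤
      Real.exp (dist (g base) base) * dist (g p).toUnitBall (g q).toUnitBall := by
  have hcosh : Real.cosh (dist (g p) base / 2) * Real.cosh (dist (g q) base / 2) ≤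
      Real.exp (dist (g base) base) *
        (Real.cosh (dist p base / 2) * Real.cosh (dist q base / 2)) := by
    rw [← add_halves (dist (g base) base), Real.exp_add, mul_mul_mul_comm]
    simpa only [add_halves] using mul_le_mul (cosh_half_dist_map_le hg p)
      (cosh_half_dist_map_le hg q) (Real.cosh_pos _).le (by positivity)
  have hsinh := sinh_half_dist_eq_dist_toUnitBall (g p) (g q)
  rw [hg.dist_eq, sinh_half_dist_eq_dist_toUnitBall, mul_assoc, mul_assoc,
    mul_right_inj' two_ne_zero] at hsinh
  refine le_of_mul_le_mul_right (hsinh.le.trans ?_)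
    (mul_pos (Real.cosh_pos (dist p base / 2)) (Real.cosh_pos (dist q base / 2)))
  linarith [mul_le_mul_of_nonneg_left hcosh
    (dist_nonneg (x := (g p).toUnitBall) (y := (g q).toUnitBall))]

end BallModel

section ClosedBall

/-- The disjoint union of hyperbolic space and its ideal boundary as the closed upper half-space
together with `∞`. -/
def closedToBall : H3 ⊕ RiemannSphere → OnePoint (ℂ × ℝ) := Sum.elim toBall RiemannSphere.toBall

theorem closedToBall_injective : Function.Injective closedToBall := by
  refine Function.Injective.sumElim (fun p q h => ?_) (Option.map_injective fun z w h => ?_) ?_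
  · have h' := OnePoint.coe_injective h
    exact H3.ext (congrArg Prod.fst h') (congrArg Prod.snd h')
  · exact congrArg Prod.fst h
  · intro p ξ h
    induction ξ using OnePoint.rec with
    | infty => exact OnePoint.coe_ne_infty _ h
    | coe z => exact p.t_pos.ne' (congrArg Prod.snd (OnePoint.coe_injective h))

theorem coe_mem_range_closedToBall {v : ℂ × ℝ} :
    (v : OnePoint (ℂ × ℝ)) ∈ Set.range closedToBall ↔ 0 ≤ v.2 := by
  constructor
  · rintro ⟨p | ξ, h⟩
    · exact OnePoint.coe_injective h ▸ p.t_pos.le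
    · induction ξ using OnePoint.rec with
      | infty => exact absurd h (OnePoint.infty_ne_coe v)
      | coe z => exact (congrArg Prod.snd (OnePoint.coe_injective h)).le
  · intro h
    rcases h.eq_or_lt with h | h
    · exact ⟨Sum.inr (v.1 : ℂ), congrArg OnePoint.some (Prod.ext rfl h)⟩
    · exact ⟨Sum.inl ⟨v.1, v.2, h⟩, rfl⟩

theorem isClosed_range_closedToBall : IsClosed (Set.range closedToBall) := by
  have hinfty : OnePoint.infty ∈ Set.range closedToBall := ⟨Sum.inr OnePoint.infty, rfl⟩
  rw [OnePoint.isClosed_iff_of_mem hinfty]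
  simp only [Set.preimage, coe_mem_range_closedToBall]
  exact isClosed_le continuous_const continuous_snd

theorem closedToBall_ne_pole (ξ : H3 ⊕ RiemannSphere) : closedToBall ξ ≠ ((0, -1) : ℂ × ℝ) :=
  fun h => absurd (coe_mem_range_closedToBall.1 ⟨ξ, h⟩) (by norm_num)

theorem exists_tendsto_closedToBall (U : Ultrafilter H3) :
    ∃ ξ, Tendsto toBall U (𝓝 (closedToBall ξ)) := by
  obtain ⟨_, ⟨ξ, rfl⟩, hξ⟩ := isClosed_range_closedToBall.isCompact.ultrafilter_le_nhds
    (U.map toBall) (le_principal_iff.2 (mem_map.2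
      (univ_mem' fun p => (⟨Sum.inl p, rfl⟩ : p.toBall ∈ Set.range closedToBall))))
  exact ⟨ξ, hξ⟩

theorem tendsto_of_tendsto_toBall {α : Type*} {l : Filter α} {x : α → H3} {p : H3}
    (hx : Tendsto (fun a => (x a).toBall) l (𝓝 p.toBall)) : Tendsto x l (𝓝 p) := by
  have hcoord : Tendsto (fun a => ((x a).z, (x a).t)) l (𝓝 (p.z, p.t)) := by
    rw [← OnePoint.comap_coe_nhds, tendsto_comap_iff]
    exact hx
  have hp := p.t_pos
  have hcont : ContinuousAt (fun v : ℂ × ℝ =>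
      2 * Real.arsinh (√(‖v.1 - p.z‖ ^ 2 + (v.2 - p.t) ^ 2) / (2 * √(v.2 * p.t)))) (p.z, p.t) := by
    have hne : 2 * √(p.t * p.t) ≠ 0 := by positivity
    fun_prop (disch := exact hne)
  rw [tendsto_iff_dist_tendsto_zero]
  simpa [dist_def, Function.comp_def] using hcont.tendsto.comp hcoord

variable {H : H3 → H3} {h : RiemannSphere → RiemannSphere}

theorem exists_tendsto_toUnitBall_map (hH : Continuous H) (hext : IsBoundaryExtension H h)
    (U : Ultrafilter H3) : ∃ ξ, Tendsto toUnitBall U (𝓝 (ballChart (closedToBall ξ))) ∧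
      Tendsto (fun p => (H p).toUnitBall) U (𝓝 (ballChart (closedToBall (Sum.map H h ξ)))) := by
  obtain ⟨ξ, hξ⟩ := exists_tendsto_closedToBall U
  refine ⟨ξ, (continuousAt_ballChart (closedToBall_ne_pole ξ)).tendsto.comp hξ, ?_⟩
  rcases ξ with p | ξ
  · exact ((continuous_toUnitBall.comp hH).tendsto p).comp (tendsto_of_tendsto_toBall hξ)
  · exact (continuousAt_ballChart (closedToBall_ne_pole (Sum.inr (h ξ)))).tendsto.comp
      ((hext ξ).comp (tendsto_comap_iff.2 hξ))

theorem exists_le_dist_toUnitBall_map (hH : Continuous H) (hHinj : Function.Injective H)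
    (hhinj : Function.Injective h) (hext : IsBoundaryExtension H h) {κ : ℝ} (hκ : 0 < κ) :
    ∃ κ' > 0, ∀ p q : H3, κ ≤ dist p.toUnitBall q.toUnitBall →
      κ' ≤ dist (H p).toUnitBall (H q).toUnitBall := by
  have hinj : Function.Injective (ballChart ∘ closedToBall ∘ Sum.map H h) := fun ξ η he =>
    (closedToBall_injective.comp (hHinj.sumMap hhinj))
      (injOn_ballChart (closedToBall_ne_pole _) (closedToBall_ne_pole _) he)
  exact exists_pos_le_dist_of_ultrafilter_tendsto hinj (exists_tendsto_toUnitBall_map hH hext) hκ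

end ClosedBall

end H3

/-- A weak form of the equivariance `H Γ₁ H⁻¹ = Γ₂` of `H` under lattices, the first of them
cocompact: some isometries which `H` conjugates to isometries carry any given point to within a
fixed distance of `base`. -/
def IsCocompactlyEquivariant (H : H3 → H3) : Prop :=
  ∃ R : ℝ, ∀ p, ∃ γ γ' : H3 → H3, Isometry γ ∧ Isometry γ' ∧ Function.Semiconj H γ γ' ∧
    dist (γ p) H3.base ≤ R

theorem IsNiceLattice.exists_dist_base_le {Γ : Subgroup (Equiv.Perm H3)} (hΓ : IsNiceLattice Γ) :
    ∃ R : ℝ, ∀ p : H3, ∃ γ ∈ Γ, dist (γ p) H3.base ≤ R := by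
  have := hΓ.compact_quotient
  have : ContinuousConstSMul Γ H3 := ⟨fun γ => (hΓ.isometry γ γ.2).continuous⟩
  let π : H3 → MulAction.orbitRel.Quotient Γ H3 := Quotient.mk''
  have hcover : Set.univ ⊆ ⋃ n : ℕ, π '' Metric.ball H3.base n := by
    rw [← Set.image_iUnion, Metric.iUnion_ball_nat,
      Set.image_univ_of_surjective Quotient.mk''_surjective]
  obtain ⟨n, hn⟩ := isCompact_univ.elim_directed_cover (fun n : ℕ => π '' Metric.ball H3.base n)
    (fun n => isOpenMap_quotient_mk'_mul _ Metric.isOpen_ball) hcover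
    (Monotone.directed_le fun m n hmn =>
      Set.image_mono (Metric.ball_subset_ball (Nat.cast_le.2 hmn)))
  refine ⟨n, fun p => ?_⟩
  obtain ⟨q, hq, hqp⟩ := hn (Set.mem_univ (π p))
  obtain ⟨γ, rfl⟩ := (Quotient.exact hqp : MulAction.orbitRel Γ H3 q p)
  exact ⟨γ, γ.2, (Metric.mem_ball.1 hq).le⟩

theorem IsBL.continuous {X Y : Type*} [MetricSpace X] [MetricSpace Y] {f : X → Y} (hf : IsBL f) :
    Continuous f := by
  obtain ⟨-, K, hK, hbound⟩ := hf
  exact (LipschitzWith.of_dist_le_mul (K := ⟨K, zero_le_one.trans hK⟩)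
    fun x y => (hbound x y).2).continuous

theorem IsEquivariantPair.isCocompactlyEquivariant {H : Equiv.Perm H3}
    {h : RiemannSphere ≃ₜ RiemannSphere} (hHh : IsEquivariantPair H h) :
    IsCocompactlyEquivariant H := by
  obtain ⟨-, -, Γ₁, Γ₂, hΓ₁, hΓ₂, hconj, -⟩ := hHh
  obtain ⟨R, hR⟩ := hΓ₁.exists_dist_base_le
  refine ⟨R, fun p => ?_⟩
  obtain ⟨γ, hγ, hγR⟩ := hR p
  have hγ₂ : H * γ * H⁻¹ ∈ Γ₂ := hconj.subset ⟨γ, hγ, rfl⟩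
  exact ⟨γ, _, hΓ₁.isometry γ hγ, hΓ₂.isometry _ hγ₂, fun x => by simp, hγR⟩

/-- Weak quasisymmetry in the sense of Väisälä, with constant `C`: the image of a closed ball
around `c` lies in the ball around `f c` whose radius is `C` times the distance from `f c` to the
image of the bounding sphere. -/
def IsWeaklyQuasisymmetric {X Y : Type*} [Dist X] [Dist Y] (C : ℝ) (f : X → Y) : Prop :=
  ∀ c z w, dist z c ≤ dist w c → dist (f z) (f c) ≤ C * dist (f w) (f c)

namespace H3

section Boundary

variable {α : Type*} {l : Filter α} {x : α → H3}

theorem tendsto_toEuclidean_of_tendsto_toBall_coe {z : ℂ}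
    (hx : Tendsto (fun a => (x a).toBall) l (𝓝 (RiemannSphere.toBall z))) :
    Tendsto (fun a => (x a).toEuclidean) l (𝓝 (WithLp.toLp 2 (z, (0 : ℝ)))) := by
  have hcoord : Tendsto (fun a => ((x a).z, (x a).t)) l (𝓝 (z, 0)) := by
    rw [← OnePoint.comap_coe_nhds, tendsto_comap_iff]
    exact hx
  exact ((WithLp.prod_continuous_toLp 2 ℂ ℝ).tendsto _).comp hcoord

theorem tendsto_dist_toEuclidean_of_tendsto_toBall_infty
    (hx : Tendsto (fun a => (x a).toBall) l (𝓝 (RiemannSphere.toBall OnePoint.infty)))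
    (v : WithLp 2 (ℂ × ℝ)) : Tendsto (fun a => dist (x a).toEuclidean v) l atTop := by
  have hcoord : Tendsto (fun a => ((x a).z, (x a).t)) l (cocompact (ℂ × ℝ)) := by
    rw [← coclosedCompact_eq_cocompact, ← OnePoint.comap_coe_nhds_infty, tendsto_comap_iff]
    exact hx
  exact (tendsto_dist_toLp_cocompact v).comp hcoord

theorem tendsto_toUnitBall_of_tendsto_toBall {ξ : RiemannSphere}
    (hx : Tendsto (fun a => (x a).toBall) l (𝓝 ξ.toBall)) :
    Tendsto (fun a => (x a).toUnitBall) l (𝓝 (ballChart ξ.toBall)) :=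
  (continuousAt_ballChart (closedToBall_ne_pole (Sum.inr ξ))).tendsto.comp hx

theorem half_lt_one_div_sqrt {a : ℝ} (ha : |a| ≤ 1) : 1 / 2 < 1 / √(a ^ 2 + 1) := by
  have := (sq_le_one_iff_abs_le_one a).2 ha
  refine one_div_lt_one_div_of_lt (by positivity) ?_
  rw [Real.sqrt_lt' two_pos]
  linarith

theorem eventually_half_le_dist_verticalGeodesic_zero {v : ℂ} (hv : ‖v‖ = 1) :
    ∀ᶠ s in atBot,
      1 / 2 ≤ dist (verticalGeodesic v s).toUnitBall (verticalGeodesic 0 s).toUnitBall := by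
  have hlim := (tendsto_toUnitBall_of_tendsto_toBall (tendsto_verticalGeodesic_atBot v)).dist
    (tendsto_toUnitBall_of_tendsto_toBall (tendsto_verticalGeodesic_atBot 0))
  refine (hlim.eventually_const_lt ?_).mono fun s hs => hs.le
  simpa [dist_ballChart_toBall_coe, hv] using half_lt_one_div_sqrt (a := 1) (by simp)

theorem eventually_half_le_dist_verticalGeodesic_neg {u : ℂ} (hu : ‖u‖ ≤ 1) :
    ∀ᶠ s in atBot,
      1 / 2 ≤ dist (verticalGeodesic u s).toUnitBall (verticalGeodesic 0 (-s)).toUnitBall := by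
  have hlim := (tendsto_toUnitBall_of_tendsto_toBall (tendsto_verticalGeodesic_atBot u)).dist
    (tendsto_toUnitBall_of_tendsto_toBall
      ((tendsto_verticalGeodesic_atTop 0).comp tendsto_neg_atBot_atTop))
  refine (hlim.eventually_const_lt ?_).mono fun s hs => hs.le
  rw [dist_ballChart_toBall_infty]
  exact half_lt_one_div_sqrt (by rwa [abs_norm])

end Boundary

section Equivariant

variable {H : H3 → H3} {h : RiemannSphere → RiemannSphere}

theorem exists_crossRatio_toEuclidean_map_le (hH : Continuous H) (hHinj : Function.Injective H)
    (hhinj : Function.Injective h) (hext : IsBoundaryExtension H h)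
    (hequiv : IsCocompactlyEquivariant H) {κ : ℝ} (hκ : 0 < κ) :
    ∃ C : ℝ, ∀ g : H3 → H3, Isometry g → ∀ p q r s : H3,
      κ ≤ dist r.toUnitBall q.toUnitBall → κ ≤ dist p.toUnitBall s.toUnitBall →
      crossRatio (H (g p)).toEuclidean (H (g q)).toEuclidean (H (g r)).toEuclidean
        (H (g s)).toEuclidean ≤ C := by
  obtain ⟨R, hR⟩ := hequiv
  obtain ⟨κ', hκ', hmap⟩ :=
    exists_le_dist_toUnitBall_map hH hHinj hhinj hext (κ := κ / Real.exp R) (by positivity)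
  refine ⟨(κ' * κ')⁻¹, fun g hg p q r s hrq hps => ?_⟩
  obtain ⟨γ, γ', hγ, hγ', hconj, hbase⟩ := hR (g base)
  have hfar {x y : H3} (hxy : κ ≤ dist x.toUnitBall y.toUnitBall) :
      κ' ≤ dist (H (γ (g x))).toUnitBall (H (γ (g y))).toUnitBall := by
    refine hmap _ _ ((div_le_iff₀' (Real.exp_pos R)).2 (hxy.trans ?_))
    refine (dist_toUnitBall_le_of_isometry (hγ.comp hg) x y).trans ?_
    exact mul_le_mul_of_nonneg_right (Real.exp_le_exp.2 hbase) dist_nonneg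
  rw [← crossRatio_toEuclidean_map_of_isometry hγ']
  simp only [← hconj.eq]
  rw [← crossRatio_toUnitBall]
  exact crossRatio_le_inv hκ' (dist_toUnitBall_le_one _ _) (dist_toUnitBall_le_one _ _)
    (hfar hrq) (hfar hps)

variable {f : ℂ → ℂ}

theorem tendsto_crossRatio_map_verticalGeodesic (hext : IsBoundaryExtension H h)
    (hinfty : h OnePoint.infty = OnePoint.infty) (hf : ∀ z : ℂ, h z = f z) {c z w : ℂ}
    (hwc : f w ≠ f c) (k : ℝ) :
    Tendsto (fun s => crossRatio (H (verticalGeodesic z (s + k))).toEuclidean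
        (H (verticalGeodesic c (s + k))).toEuclidean (H (verticalGeodesic w (s + k))).toEuclidean
        (H (verticalGeodesic c (-s + k))).toEuclidean)
      atBot (𝓝 (dist (f z) (f c) / dist (f w) (f c))) := by
  have hfin (ζ : ℂ) : Tendsto (fun s => (H (verticalGeodesic ζ (s + k))).toEuclidean) atBot
      (𝓝 (WithLp.toLp 2 (f ζ, (0 : ℝ)))) := by
    refine tendsto_toEuclidean_of_tendsto_toBall_coe ?_
    rw [← hf]
    exact (hext ζ).comp (tendsto_comap_iff.2 ((tendsto_verticalGeodesic_atBot ζ).comp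
      (tendsto_atBot_add_const_right _ k tendsto_id)))
  have hinf (v : WithLp 2 (ℂ × ℝ)) :
      Tendsto (fun s => dist (H (verticalGeodesic c (-s + k))).toEuclidean v) atBot atTop := by
    refine tendsto_dist_toEuclidean_of_tendsto_toBall_infty ?_ v
    rw [← hinfty]
    exact (hext OnePoint.infty).comp (tendsto_comap_iff.2 ((tendsto_verticalGeodesic_atTop c).comp
      (tendsto_atTop_add_const_right _ k tendsto_neg_atBot_atTop)))
  rw [← dist_toLp_mk_zero (f z), ← dist_toLp_mk_zero (f w)]
  refine tendsto_crossRatio (hfin z) (hfin c) (hfin w) (hinf _) ?_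
  rwa [dist_toLp_mk_zero, dist_ne_zero]

theorem exists_isWeaklyQuasisymmetric_of_isBoundaryExtension (hH : Continuous H)
    (hHinj : Function.Injective H) (hhinj : Function.Injective h) (hext : IsBoundaryExtension H h)
    (hequiv : IsCocompactlyEquivariant H) (hinfty : h OnePoint.infty = OnePoint.infty)
    (hf : ∀ z : ℂ, h z = f z) : ∃ C, IsWeaklyQuasisymmetric C f := by
  obtain ⟨C, hC⟩ :=
    exists_crossRatio_toEuclidean_map_le hH hHinj hhinj hext hequiv (one_half_pos (α := ℝ))
  refine ⟨C, fun c z w hzw => ?_⟩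
  rcases eq_or_ne w c with rfl | hwc
  · rw [dist_self, dist_le_zero] at hzw
    simp [hzw]
  have hfwc : f w ≠ f c := fun he => hwc (OnePoint.coe_injective (hhinj (by rw [hf, hf, he])))
  rw [← div_le_iff₀ (dist_pos.2 hfwc)]
  set a := dist w c
  have ha : 0 < a := dist_pos.2 hwc
  have hnorm (ζ : ℂ) : ‖(ζ - c) / a‖ = dist ζ c / a := by
    rw [norm_div, Complex.norm_real, Real.norm_of_nonneg ha.le, dist_eq_norm]
  have hgeod (ζ : ℂ) (s : ℝ) : verticalGeodesic ζ (s + Real.log a) =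
      similarity a ha c (verticalGeodesic ((ζ - c) / a) s) := by
    rw [similarity_verticalGeodesic, mul_div_cancel₀ _ (Complex.ofReal_ne_zero.2 ha.ne'),
      sub_add_cancel]
  refine le_of_tendsto
    (tendsto_crossRatio_map_verticalGeodesic hext hinfty hf hfwc (Real.log a)) ?_
  filter_upwards [
    eventually_half_le_dist_verticalGeodesic_zero ((hnorm w).trans (div_self ha.ne')),
    eventually_half_le_dist_verticalGeodesic_neg
      ((hnorm z).trans_le (div_le_one_of_le₀ hzw ha.le))] with s hw hz
  simp only [hgeod, sub_self, zero_div]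
  exact hC _ (isometry_similarity ha c) _ _ _ _ hw hz

end Equivariant

end H3

/-- The length–area condition: for every disc, the squared distance between the images of the end
points of its horizontal diameter is at most its `μ`-measure. For a quasiconformal map, `μ` is a
multiple of the area of the image. -/
def IsLengthAreaBounded {Y : Type*} [Dist Y] (f : ℂ → Y) (μ : Measure ℂ) : Prop :=
  ∀ (c : ℂ) (r : ℝ), 0 ≤ r → dist (f (c - r)) (f (c + r)) ^ 2 ≤ μ.real (Metric.ball c r)

/-- Absolute continuity on almost every horizontal line, that is, on each of its compact segments:
the ACL property of quasiconformal maps in one direction only. -/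
def IsHorizontallyACL {Y : Type*} [PseudoMetricSpace Y] (f : ℂ → Y) : Prop :=
  ∀ a b : ℝ, ∀ᵐ y : ℝ, AbsolutelyContinuousOnInterval (fun x : ℝ => f ⟨x, y⟩) a b

theorem ball_subset_image_ball {X E : Type*} [PseudoMetricSpace X] [NormedAddCommGroup E]
    [NormedSpace ℝ E] (F : X ≃ₜ E) {c : X} {r s : ℝ} (hr : 0 < r)
    (hs : ∀ w, dist w c = r → s ≤ dist (F w) (F c)) :
    Metric.ball (F c) s ⊆ F '' Metric.ball c r := by
  intro u hu
  refine ⟨F.symm u, ?_, F.apply_symm_apply u⟩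
  by_contra! hur
  rw [Metric.mem_ball, not_lt] at hur
  have hcont : ContinuousOn (fun v => dist (F.symm v) c) (Metric.ball (F c) s) :=
    (F.symm.continuous.dist continuous_const).continuousOn
  obtain ⟨v, hv, hvr⟩ := (convex_ball (F c) s).isPreconnected.intermediate_value
    (Metric.mem_ball_self (dist_nonneg.trans_lt hu)) hu hcont
    (show r ∈ Set.Icc _ _ by simpa using ⟨hr.le, hur⟩)
  have := hs _ hvr
  rw [F.apply_symm_apply] at this
  exact this.not_gt hv

theorem IsWeaklyQuasisymmetric.pos {X Y : Type*} [PseudoMetricSpace X] [MetricSpace Y]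
    [Nontrivial X] {C : ℝ} {f : X → Y} (hf : IsWeaklyQuasisymmetric C f)
    (hinj : Function.Injective f) : 0 < C := by
  obtain ⟨z, c, hzc⟩ := exists_pair_ne X
  have hpos : 0 < dist (f z) (f c) := dist_pos.2 (hinj.ne hzc)
  exact pos_of_mul_pos_left (hpos.trans_le (hf c z z le_rfl)) hpos.le

theorem IsWeaklyQuasisymmetric.dist_sq_le_volume_image_ball {X : Type*} [PseudoMetricSpace X]
    [ProperSpace X] {F : X ≃ₜ ℂ} {C : ℝ} (hF : IsWeaklyQuasisymmetric C F) (hC : 0 < C) {a b c : X}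
    {r : ℝ} (ha : dist a c = r) (hb : dist b c = r) :
    dist (F a) (F b) ^ 2 ≤ 4 * C ^ 2 * volume.real (F '' Metric.ball c r) := by
  rcases (dist_nonneg.trans_eq ha).eq_or_lt with rfl | hr
  · have hca := hF c a c (by rw [ha, dist_self])
    have hcb := hF c b c (by rw [hb, dist_self])
    simp only [dist_self, mul_zero, dist_le_zero] at hca hcb
    simp [hca, hcb]
  set D := dist (F a) (F b)
  have hsphere (w : X) (hw : dist w c = r) : D / (2 * C) ≤ dist (F w) (F c) := by
    rw [div_le_iff₀' (by positivity)]
    linarith [dist_triangle_right (F a) (F b) (F c), hF c a w (ha.trans hw.symm).le,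
      hF c b w (hb.trans hw.symm).le]
  have hfin : volume (F '' Metric.ball c r) ≠ ⊤ :=
    ((((isCompact_closedBall c r).image F.continuous).isBounded.subset
      (Set.image_mono Metric.ball_subset_closedBall)).measure_lt_top).ne
  have harea : Real.pi * (D / (2 * C)) ^ 2 ≤ volume.real (F '' Metric.ball c r) := by
    refine le_trans (le_of_eq ?_) (measureReal_mono (ball_subset_image_ball F hr hsphere) hfin)
    rw [measureReal_def, Complex.volume_ball, ENNReal.toReal_mul, ENNReal.toReal_pow,
      ENNReal.toReal_ofReal (by positivity), mul_comm]
    rfl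
  calc D ^ 2 = 4 * C ^ 2 * (1 * (D / (2 * C)) ^ 2) := by field_simp; ring
    _ ≤ 4 * C ^ 2 * (Real.pi * (D / (2 * C)) ^ 2) := by
      gcongr
      exact Real.one_le_pi_div_two.trans (half_le_self Real.pi_pos.le)
    _ ≤ _ := by gcongr

theorem IsWeaklyQuasisymmetric.exists_isLengthAreaBounded {F : ℂ ≃ₜ ℂ} {C : ℝ}
    (hF : IsWeaklyQuasisymmetric C F) :
    ∃ μ : Measure ℂ, IsLocallyFiniteMeasure μ ∧ IsLengthAreaBounded F μ := by
  have := IsFiniteMeasureOnCompacts.comap' (volume : Measure ℂ) F.continuous F.measurableEmbedding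
  let K : NNReal := ⟨4 * C ^ 2, by positivity⟩
  have := IsFiniteMeasureOnCompacts.smul_nnreal (volume.comap F) K
  refine ⟨K • volume.comap F, isLocallyFiniteMeasure_of_isFiniteMeasureOnCompacts,
    fun c r hr => ?_⟩
  rw [measureReal_nnreal_smul_apply, measureReal_def, F.measurableEmbedding.comap_apply]
  exact hF.dist_sq_le_volume_image_ball (hF.pos F.injective)
    (by simp [abs_of_nonneg hr]) (by simp [abs_of_nonneg hr])

theorem sum_measureReal_le_measureReal {α ι : Type*} [MeasurableSpace α] {μ : Measure α}
    {s : Finset ι} {B : ι → Set α} {U : Set α} (hdisj : Set.PairwiseDisjoint (s : Set ι) B)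
    (hmeas : ∀ i ∈ s, MeasurableSet (B i)) (hsub : ∀ i ∈ s, B i ⊆ U) (hU : μ U ≠ ⊤) :
    ∑ i ∈ s, μ.real (B i) ≤ μ.real U := by
  rw [← measureReal_biUnion_finset hdisj hmeas fun i hi => measure_ne_top_of_subset (hsub i hi) hU]
  exact measureReal_mono (Set.iUnion₂_subset hsub) hU

section Line

variable {Y : Type*} [PseudoMetricSpace Y] {g : ℝ → Y} {ν : Measure ℝ} [IsLocallyFiniteMeasure ν]

theorem dist_sq_le_nat_mul_measureReal_Ioo {η : ℝ}
    (hg : ∀ a b, a ≤ b → b - a ≤ η → dist (g a) (g b) ^ 2 ≤ ν.real (Set.Ioo a b))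
    {a b : ℝ} (hab : a ≤ b) {n : ℕ} (hn : b - a ≤ n * η) :
    dist (g a) (g b) ^ 2 ≤ n * ν.real (Set.Ioo a b) := by
  rcases n.eq_zero_or_pos with rfl | hnpos
  · obtain rfl : a = b := by linarith [show b - a ≤ 0 by simpa using hn]
    simp
  have hnpos' : (0 : ℝ) < n := Nat.cast_pos.2 hnpos
  set ℓ := (b - a) / n
  have hℓ : 0 ≤ ℓ := div_nonneg (sub_nonneg.2 hab) hnpos'.le
  let x (j : ℕ) : ℝ := a + j * ℓ
  have hx : Monotone x := fun i j hij => by simp only [x]; gcongr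
  have hx₀ : x 0 = a := by simp [x]
  have hxn : x n = b := by simp only [x, ℓ]; field_simp; ring
  have hstep (j : ℕ) : dist (g (x j)) (g (x (j + 1))) ^ 2 ≤ ν.real (Set.Ioo (x j) (x (j + 1))) := by
    refine hg _ _ (hx j.le_succ) ?_
    have : x (j + 1) - x j = ℓ := by simp only [x]; push_cast; ring
    rwa [this, div_le_iff₀' hnpos']
  have hsub (j : ℕ) (hj : j ∈ Finset.range n) : Set.Ioo (x j) (x (j + 1)) ⊆ Set.Ioo a b :=
    Set.Ioo_subset_Ioo (hx₀ ▸ hx j.zero_le) (hxn ▸ hx (Finset.mem_range.1 hj))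
  calc dist (g a) (g b) ^ 2
      ≤ (∑ j ∈ Finset.range n, dist (g (x j)) (g (x (j + 1)))) ^ 2 := by
        gcongr
        simpa only [hx₀, hxn] using dist_le_range_sum_dist (fun j => g (x j)) n
    _ ≤ n * ∑ j ∈ Finset.range n, dist (g (x j)) (g (x (j + 1))) ^ 2 := by
        simpa only [Finset.card_range] using sq_sum_le_card_mul_sum_sq (s := Finset.range n)
          (f := fun j => dist (g (x j)) (g (x (j + 1))))
    _ ≤ n * ∑ j ∈ Finset.range n, ν.real (Set.Ioo (x j) (x (j + 1))) := by
        gcongr with j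
        exact hstep j
    _ ≤ n * ν.real (Set.Ioo a b) := by
        gcongr
        exact sum_measureReal_le_measureReal (hx.pairwise_disjoint_on_Ioo_succ.set_pairwise _)
          (fun j _ => measurableSet_Ioo) hsub measure_Ioo_lt_top.ne

theorem sum_dist_sq_le_measureReal_uIcc {η : ℝ} (hη : 0 < η)
    (hg : ∀ a b, a ≤ b → b - a ≤ η → dist (g a) (g b) ^ 2 ≤ ν.real (Set.Ioo a b))
    {a b : ℝ} {E : ℕ × (ℕ → ℝ × ℝ)} (hE : E ∈ AbsolutelyContinuousOnInterval.disjWithin a b) :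
    (∑ i ∈ Finset.range E.1, dist (g (E.2 i).1) (g (E.2 i).2)) ^ 2 ≤
      ((∑ i ∈ Finset.range E.1, dist (E.2 i).1 (E.2 i).2) / η + E.1) *
        ν.real (Set.uIcc a b) := by
  let n (i : ℕ) : ℕ := ⌈dist (E.2 i).1 (E.2 i).2 / η⌉₊
  have hn (i : ℕ) : (n i : ℝ) ≤ dist (E.2 i).1 (E.2 i).2 / η + 1 :=
    (Nat.ceil_lt_add_one (by positivity)).le
  have hterm (p q : ℝ) : dist (g p) (g q) ^ 2 ≤ ⌈dist p q / η⌉₊ * ν.real (Set.uIoo p q) := by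
    wlog hpq : p ≤ q generalizing p q
    · simpa only [dist_comm, Set.uIoo_comm] using this q p (le_of_not_ge hpq)
    rw [Set.uIoo_of_le hpq]
    refine dist_sq_le_nat_mul_measureReal_Ioo hg hpq ?_
    rw [← div_le_iff₀ hη, dist_comm, Real.dist_eq, abs_of_nonneg (sub_nonneg.2 hpq)]
    exact Nat.le_ceil _
  have hIoo (i : ℕ) : Set.uIoo (E.2 i).1 (E.2 i).2 ⊆ Set.uIoc (E.2 i).1 (E.2 i).2 :=
    Set.Ioo_subset_Ioc_self
  have hdisj : Set.PairwiseDisjoint (Finset.range E.1 : Set ℕ)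
      fun i => Set.uIoo (E.2 i).1 (E.2 i).2 := hE.2.mono hIoo
  have hsub (i : ℕ) (hi : i ∈ Finset.range E.1) :
      Set.uIoo (E.2 i).1 (E.2 i).2 ⊆ Set.uIcc a b :=
    ((hIoo i).trans (AbsolutelyContinuousOnInterval.uIoc_subset_of_mem_disjWithin hE
      (Finset.mem_range.1 hi))).trans Set.uIoc_subset_uIcc
  calc (∑ i ∈ Finset.range E.1, dist (g (E.2 i).1) (g (E.2 i).2)) ^ 2
      ≤ (∑ i ∈ Finset.range E.1, (n i : ℝ)) *
          ∑ i ∈ Finset.range E.1, ν.real (Set.uIoo (E.2 i).1 (E.2 i).2) :=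
        Finset.sum_sq_le_sum_mul_sum_of_sq_le_mul _ (fun i _ => Nat.cast_nonneg _)
          (fun i _ => measureReal_nonneg) fun i _ => hterm _ _
    _ ≤ (∑ i ∈ Finset.range E.1, (dist (E.2 i).1 (E.2 i).2 / η + 1)) *
          ν.real (Set.uIcc a b) :=
        mul_le_mul (Finset.sum_le_sum fun i _ => hn i)
          (sum_measureReal_le_measureReal hdisj (fun i _ => measurableSet_Ioo) hsub
            isCompact_uIcc.measure_lt_top.ne)
          (Finset.sum_nonneg fun i _ => measureReal_nonneg)
          (Finset.sum_nonneg fun i _ => by positivity)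
    _ = _ := by simp [Finset.sum_add_distrib, Finset.sum_div]

theorem ae_exists_eventually_measureReal_closedBall_le (ν : Measure ℝ) [IsLocallyFiniteMeasure ν] :
    ∀ᵐ y : ℝ, ∃ M : ℝ, 0 ≤ M ∧ ∀ᶠ δ in 𝓝[>] (0 : ℝ),
      ν.real (Metric.closedBall y δ) ≤ M * (2 * δ) := by
  filter_upwards [Besicovitch.ae_tendsto_rnDeriv ν volume, ν.rnDeriv_lt_top volume] with y hy hfin
  obtain ⟨M, hM, -⟩ := ENNReal.lt_iff_exists_nnreal_btwn.1 hfin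
  refine ⟨M, M.2, ?_⟩
  filter_upwards [hy.eventually_lt_const hM, self_mem_nhdsWithin] with δ hδM hδ
  rw [Set.mem_Ioi] at hδ
  have := ENNReal.toReal_mono ENNReal.coe_ne_top hδM.le
  rwa [Real.volume_closedBall, ENNReal.toReal_div, ENNReal.toReal_ofReal (by positivity),
    div_le_iff₀ (by positivity)] at this

end Line

theorem absolutelyContinuousOnInterval_of_sum_dist_sq_le {Y : Type*} [PseudoMetricSpace Y]
    {g : ℝ → Y} {a b M : ℝ} (hM : 0 ≤ M)
    (hg : ∀ E ∈ AbsolutelyContinuousOnInterval.disjWithin a b,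
      (∑ i ∈ Finset.range E.1, dist (g (E.2 i).1) (g (E.2 i).2)) ^ 2 ≤
        M * ∑ i ∈ Finset.range E.1, dist (E.2 i).1 (E.2 i).2) :
    AbsolutelyContinuousOnInterval g a b := by
  rw [absolutelyContinuousOnInterval_iff]
  intro ε hε
  refine ⟨ε ^ 2 / (M + 1), by positivity, fun E hE hlt => ?_⟩
  rw [lt_div_iff₀ (by positivity)] at hlt
  have hS : 0 ≤ ∑ i ∈ Finset.range E.1, dist (E.2 i).1 (E.2 i).2 :=
    Finset.sum_nonneg fun i _ => dist_nonneg
  exact lt_of_pow_lt_pow_left₀ 2 hε.le (by linarith [hg E hE])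

section Strip

variable {μ : Measure ℂ} {s t : Set ℝ}

theorem measurableSet_reProdIm (hs : MeasurableSet s) (ht : MeasurableSet t) :
    MeasurableSet (s ×ℂ t) :=
  (Complex.measurable_re hs).inter (Complex.measurable_im ht)

theorem map_re_restrict_apply (hs : MeasurableSet s) :
    (μ.restrict (Complex.im ⁻¹' t)).map Complex.re s = μ (s ×ℂ t) := by
  rw [Measure.map_apply Complex.measurable_re hs,
    Measure.restrict_apply (Complex.measurable_re hs)]
  rfl

theorem map_im_restrict_apply (ht : MeasurableSet t) :
    (μ.restrict (Complex.re ⁻¹' s)).map Complex.im t = μ (s ×ℂ t) := by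
  rw [Measure.map_apply Complex.measurable_im ht,
    Measure.restrict_apply (Complex.measurable_im ht), Set.inter_comm]
  rfl

theorem isLocallyFiniteMeasure_map_re_restrict [IsLocallyFiniteMeasure μ]
    (ht : Bornology.IsBounded t) :
    IsLocallyFiniteMeasure ((μ.restrict (Complex.im ⁻¹' t)).map Complex.re) := by
  refine ⟨fun x => ⟨Metric.closedBall x 1, Metric.closedBall_mem_nhds x one_pos, ?_⟩⟩
  rw [map_re_restrict_apply measurableSet_closedBall]
  exact (Metric.isBounded_closedBall.reProdIm ht).measure_lt_top

theorem isLocallyFiniteMeasure_map_im_restrict [IsLocallyFiniteMeasure μ]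
    (hs : Bornology.IsBounded s) :
    IsLocallyFiniteMeasure ((μ.restrict (Complex.re ⁻¹' s)).map Complex.im) := by
  refine ⟨fun y => ⟨Metric.closedBall y 1, Metric.closedBall_mem_nhds y one_pos, ?_⟩⟩
  rw [map_im_restrict_apply measurableSet_closedBall]
  exact (hs.reProdIm Metric.isBounded_closedBall).measure_lt_top

end Strip

theorem ball_subset_Ioo_reProdIm_closedBall {a b y δ : ℝ} (hδ : b - a ≤ 2 * δ) :
    Metric.ball (⟨(a + b) / 2, y⟩ : ℂ) ((b - a) / 2) ⊆
      Set.Ioo a b ×ℂ Metric.closedBall y δ := by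
  intro z hz
  rw [Metric.mem_ball, dist_eq_norm] at hz
  have hre := abs_lt.1 ((Complex.abs_re_le_norm _).trans_lt hz)
  have him := (Complex.abs_im_le_norm _).trans_lt hz
  rw [Complex.sub_re] at hre
  refine ⟨⟨by linarith [hre.1], by linarith [hre.2]⟩, ?_⟩
  rw [Set.mem_preimage, Metric.mem_closedBall, Real.dist_eq]
  exact him.le.trans (by linarith)

namespace IsLengthAreaBounded

variable {Y : Type*} [PseudoMetricSpace Y] {f : ℂ → Y} {μ : Measure ℂ} [IsLocallyFiniteMeasure μ]

theorem dist_sq_le_measureReal_Ioo_reProdIm (hf : IsLengthAreaBounded f μ) {a b y δ : ℝ}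
    (hab : a ≤ b) (hδ : b - a ≤ 2 * δ) :
    dist (f ⟨a, y⟩) (f ⟨b, y⟩) ^ 2 ≤ μ.real (Set.Ioo a b ×ℂ Metric.closedBall y δ) := by
  have hdisc := hf ⟨(a + b) / 2, y⟩ ((b - a) / 2) (by linarith)
  have hl : (⟨(a + b) / 2, y⟩ - ((b - a) / 2 : ℝ) : ℂ) = ⟨a, y⟩ := by
    apply Complex.ext <;> simp; ring
  have hr : (⟨(a + b) / 2, y⟩ + ((b - a) / 2 : ℝ) : ℂ) = ⟨b, y⟩ := by
    apply Complex.ext <;> simp; ring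
  rw [hl, hr] at hdisc
  exact hdisc.trans (measureReal_mono (ball_subset_Ioo_reProdIm_closedBall hδ)
    ((Metric.isBounded_Ioo a b).reProdIm Metric.isBounded_closedBall).measure_lt_top.ne)

theorem sum_dist_sq_le_measureReal_strip (hf : IsLengthAreaBounded f μ) {a b y δ : ℝ} (hδ : 0 < δ)
    {E : ℕ × (ℕ → ℝ × ℝ)} (hE : E ∈ AbsolutelyContinuousOnInterval.disjWithin a b) :
    (∑ i ∈ Finset.range E.1, dist (f ⟨(E.2 i).1, y⟩) (f ⟨(E.2 i).2, y⟩)) ^ 2 ≤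
      ((∑ i ∈ Finset.range E.1, dist (E.2 i).1 (E.2 i).2) / (2 * δ) + E.1) *
        μ.real (Set.uIcc a b ×ℂ Metric.closedBall y δ) := by
  have := isLocallyFiniteMeasure_map_re_restrict (μ := μ)
    (Metric.isBounded_closedBall (x := y) (r := δ))
  have hsum := sum_dist_sq_le_measureReal_uIcc (g := fun x : ℝ => f ⟨x, y⟩)
    (ν := (μ.restrict (Complex.im ⁻¹' Metric.closedBall y δ)).map Complex.re) (η := 2 * δ)
    (by positivity) (fun p q hpq hη => by
      rw [measureReal_def, map_re_restrict_apply measurableSet_Ioo]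
      exact hf.dist_sq_le_measureReal_Ioo_reProdIm hpq hη) hE
  rwa [measureReal_def, map_re_restrict_apply measurableSet_uIcc] at hsum

theorem isHorizontallyACL (hf : IsLengthAreaBounded f μ) : IsHorizontallyACL f := by
  intro a b
  have := isLocallyFiniteMeasure_map_im_restrict (μ := μ) (s := Set.uIcc a b)
    (Metric.isBounded_Icc _ _)
  filter_upwards [ae_exists_eventually_measureReal_closedBall_le
    ((μ.restrict (Complex.re ⁻¹' Set.uIcc a b)).map Complex.im)] with y hy
  obtain ⟨M, hM, hstrip⟩ := hy
  refine absolutelyContinuousOnInterval_of_sum_dist_sq_le hM fun E hE => ?_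
  set S := ∑ i ∈ Finset.range E.1, dist (E.2 i).1 (E.2 i).2
  have hlim : Tendsto (fun δ : ℝ => M * (S + E.1 * (2 * δ))) (𝓝[>] 0) (𝓝 (M * S)) := by
    have : Continuous fun δ : ℝ => M * (S + E.1 * (2 * δ)) := by fun_prop
    simpa using (this.tendsto 0).mono_left nhdsWithin_le_nhds
  refine ge_of_tendsto hlim ?_
  filter_upwards [hstrip, self_mem_nhdsWithin] with δ hδM hδ
  rw [Set.mem_Ioi] at hδ
  rw [measureReal_def, map_im_restrict_apply measurableSet_closedBall, ← measureReal_def] at hδM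
  calc _ ≤ (S / (2 * δ) + E.1) * μ.real (Set.uIcc a b ×ℂ Metric.closedBall y δ) :=
        hf.sum_dist_sq_le_measureReal_strip hδ hE
    _ ≤ (S / (2 * δ) + E.1) * (M * (2 * δ)) := by gcongr
    _ = M * (S + E.1 * (2 * δ)) := by field_simp

end IsLengthAreaBounded

theorem ae_iff_ae_ae_line {p : ℂ → Prop} (hp : MeasurableSet {z | p z}) :
    (∀ᵐ z, p z) ↔ ∀ᵐ y : ℝ, ∀ᵐ x : ℝ, p ⟨x, y⟩ := by
  have hp' : MeasurableSet {q : ℝ × ℝ | p ⟨q.2, q.1⟩} :=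
    (Complex.measurableEquivRealProd.symm.measurable.comp measurable_swap) hp
  rw [← Measure.ae_prod_iff_ae_ae hp', ← Measure.volume_eq_prod]
  have hmp := Complex.volume_preserving_equiv_real_prod.symm.comp
    (Measure.measurePreserving_swap (μ := volume) (ν := volume))
  rw [← hmp.map_eq]
  exact ae_map_iff hmp.aemeasurable hp

theorem exists_Icc_reProdIm_subset {U : Set ℂ} (hU : (interior U).Nonempty) :
    ∃ a b c d : ℝ, a < b ∧ c < d ∧ Set.Icc a b ×ℂ Set.Icc c d ⊆ U := by
  obtain ⟨z, hz⟩ := hU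
  obtain ⟨ε, hε, hball⟩ := Metric.isOpen_iff.1 isOpen_interior z hz
  refine ⟨z.re, z.re + ε / 3, z.im, z.im + ε / 3, by linarith, by linarith, fun w hw => ?_⟩
  obtain ⟨⟨hre, hre'⟩, him, him'⟩ := hw
  refine interior_subset (hball ?_)
  have hnorm := Complex.norm_le_abs_re_add_abs_im (w - z)
  rw [Complex.sub_re, Complex.sub_im, abs_of_nonneg (sub_nonneg.2 hre),
    abs_of_nonneg (sub_nonneg.2 him)] at hnorm
  rw [Metric.mem_ball, dist_eq_norm]
  linarith

section LineDeriv

variable {𝕜 V E : Type*} [NontriviallyNormedField 𝕜] [AddCommGroup V] [Module 𝕜 V]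
  [NormedAddCommGroup E] [NormedSpace 𝕜 E] {f : V → E} {z v : V}

theorem exists_hasLineDerivAt_iff :
    (∃ c, HasLineDerivAt 𝕜 f c z v) ↔ LineDifferentiableAt 𝕜 f z v :=
  ⟨fun ⟨_, hc⟩ => hc.lineDifferentiableAt, fun hd => ⟨_, hd.hasLineDerivAt⟩⟩

theorem exists_ne_zero_hasLineDerivAt_iff :
    (∃ c, c ≠ 0 ∧ HasLineDerivAt 𝕜 f c z v) ↔ lineDeriv 𝕜 f z v ≠ 0 := by
  refine ⟨fun ⟨c, hc, hd⟩ => hd.lineDeriv.trans_ne hc, fun hne => ⟨_, hne, ?_⟩⟩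
  exact (not_imp_comm.1 lineDeriv_zero_of_not_lineDifferentiableAt hne).hasLineDerivAt

end LineDeriv

section HorizontalDerivative

variable {E : Type*} [NormedAddCommGroup E] [NormedSpace ℝ E] {f : ℂ → E}

theorem hasLineDerivAt_one_iff {x y : ℝ} {c : E} :
    HasLineDerivAt ℝ f c ⟨x, y⟩ 1 ↔ HasDerivAt (fun x : ℝ => f ⟨x, y⟩) c x := by
  have hline (t : ℝ) : (⟨x, y⟩ : ℂ) + t • (1 : ℂ) = ⟨x + t, y⟩ := by apply Complex.ext <;> simp
  simp only [HasLineDerivAt, hline]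
  refine ⟨fun hd => ?_, fun hd => HasDerivAt.comp_const_add x 0 (by rwa [add_zero])⟩
  have hd' : HasDerivAt (fun t : ℝ => f ⟨x + t, y⟩) c (x - x) := by rwa [sub_self]
  simpa only [add_sub_cancel] using hd'.comp_sub_const x x

namespace IsHorizontallyACL

theorem ae_lineDifferentiableAt [FiniteDimensional ℝ E] (hf : IsHorizontallyACL f)
    (hcont : Continuous f) : ∀ᵐ z, LineDifferentiableAt ℝ f z 1 := by
  have := FiniteDimensional.complete ℝ E
  rw [ae_iff_ae_ae_line (measurableSet_lineDifferentiableAt hcont)]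
  filter_upwards [ae_all_iff.2 fun n : ℕ => hf (-n) n] with y hy
  filter_upwards [ae_all_iff.2 fun n : ℕ =>
    (hy n).boundedVariationOn.ae_differentiableAt_of_mem_uIcc] with x hx
  obtain ⟨n, hn⟩ := exists_nat_ge |x|
  exact (hasLineDerivAt_one_iff.2
    (hx n (Set.mem_uIcc_of_le (abs_le.1 hn).1 (abs_le.1 hn).2)).hasDerivAt).lineDifferentiableAt

theorem ae_eq_of_ae_lineDeriv_eq_zero [FiniteDimensional ℝ E] (hf : IsHorizontallyACL f)
    (hcont : Continuous f) {a b : ℝ} {t : Set ℝ} (ht : MeasurableSet t)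
    (hzero : ∀ᵐ z, z ∈ Set.uIcc a b ×ℂ t → lineDeriv ℝ f z 1 = 0) :
    ∀ᵐ y, y ∈ t → f ⟨a, y⟩ = f ⟨b, y⟩ := by
  have := FiniteDimensional.complete ℝ E
  borelize E
  have hmeas : MeasurableSet {z | z ∈ Set.uIcc a b ×ℂ t →
      LineDifferentiableAt ℝ f z 1 ∧ lineDeriv ℝ f z 1 = 0} :=
    (measurableSet_reProdIm measurableSet_uIcc ht).imp
      ((measurableSet_lineDifferentiableAt hcont).inter
        (measurable_lineDeriv hcont (measurableSet_singleton 0)))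
  have hline := (ae_iff_ae_ae_line hmeas).1 (by
    filter_upwards [hzero, hf.ae_lineDifferentiableAt hcont] with z hz hd hzt
    exact ⟨hd, hz hzt⟩)
  filter_upwards [hf a b, hline] with y hac hy hyt
  obtain ⟨c, hc⟩ := hac.const_of_ae_hasDerivAt_zero (by
    filter_upwards [hy] with x hx hxab
    obtain ⟨hd, hd₀⟩ := hx ⟨hxab, hyt⟩
    exact hasLineDerivAt_one_iff.1 (hd₀ ▸ hd.hasLineDerivAt))
  exact (hc a Set.left_mem_uIcc).trans (hc b Set.right_mem_uIcc).symm

theorem volume_lineDeriv_ne_zero_pos [FiniteDimensional ℝ E] (hf : IsHorizontallyACL f)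
    (hcont : Continuous f) (hinj : Function.Injective f) {U : Set ℂ} (hU : (interior U).Nonempty) :
    0 < volume {z ∈ U | lineDeriv ℝ f z 1 ≠ 0} := by
  obtain ⟨a, b, c, d, hab, hcd, hsub⟩ := exists_Icc_reProdIm_subset hU
  rw [pos_iff_ne_zero]
  intro hnull
  have hzero : ∀ᵐ z, z ∈ Set.uIcc a b ×ℂ Set.Icc c d → lineDeriv ℝ f z 1 = 0 := by
    filter_upwards [measure_eq_zero_iff_ae_notMem.1 hnull] with z hz hmem
    rw [Set.uIcc_of_le hab.le] at hmem
    exact not_not.1 fun hne => hz ⟨hsub hmem, hne⟩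
  have hnotMem : ∀ᵐ y, y ∉ Set.Icc c d := by
    filter_upwards [hf.ae_eq_of_ae_lineDeriv_eq_zero hcont measurableSet_Icc hzero] with y hy hmem
    exact hab.ne (congrArg Complex.re (hinj (hy hmem)))
  rw [← measure_eq_zero_iff_ae_notMem, Real.volume_Icc, ENNReal.ofReal_eq_zero] at hnotMem
  linarith

end IsHorizontallyACL

end HorizontalDerivative

theorem exists_homeomorph_of_map_infty {X Y : Type*} [TopologicalSpace X] [TopologicalSpace Y]
    (h : OnePoint X ≃ₜ OnePoint Y) (hinfty : h OnePoint.infty = OnePoint.infty) {f : X → Y}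
    (hf : ∀ x : X, h x = f x) : ∃ F : X ≃ₜ Y, ⇑F = f := by
  have hemb : IsOpenEmbedding f := by
    refine IsOpenEmbedding.of_comp f OnePoint.isOpenEmbedding_coe ?_
    rw [show (↑) ∘ f = h ∘ (↑) from funext fun x => (hf x).symm]
    exact h.isOpenEmbedding.comp OnePoint.isOpenEmbedding_coe
  have hsurj : Function.Surjective f := by
    intro y
    have hy : h.symm y ≠ OnePoint.infty := by
      rw [Ne, h.symm_apply_eq, hinfty]
      exact OnePoint.coe_ne_infty y
    obtain ⟨x, hx⟩ := OnePoint.ne_infty_iff_exists.1 hy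
    exact ⟨x, OnePoint.coe_injective (by rw [← hf, hx, h.apply_symm_apply])⟩
  exact ⟨(Equiv.ofBijective f ⟨hemb.injective, hsurj⟩).toHomeomorphOfIsInducing hemb.isInducing,
    rfl⟩

theorem mainTheorem11_general {H : H3 → H3} (hH : Continuous H) (hHinj : Function.Injective H)
    (hequiv : IsCocompactlyEquivariant H) {h : RiemannSphere ≃ₜ RiemannSphere}
    (hext : IsBoundaryExtension H h) (hinfty : h OnePoint.infty = OnePoint.infty)
    {f : ℂ → ℂ} (hf : ∀ z : ℂ, h z = f z) :
    volume {z | ¬ ∃ c : ℂ, HasLineDerivAt ℝ f c z 1} = 0 ∧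
      ∀ U : Set ℂ, (interior U).Nonempty →
        0 < volume {z ∈ U | ∃ c : ℂ, c ≠ 0 ∧ HasLineDerivAt ℝ f c z 1} := by
  obtain ⟨C, hC⟩ := H3.exists_isWeaklyQuasisymmetric_of_isBoundaryExtension hH hHinj h.injective
    hext hequiv hinfty hf
  obtain ⟨F, rfl⟩ := exists_homeomorph_of_map_infty h hinfty hf
  obtain ⟨μ, hμ, hFμ⟩ := hC.exists_isLengthAreaBounded
  have hacl : IsHorizontallyACL F := hFμ.isHorizontallyACL
  simp only [exists_hasLineDerivAt_iff, exists_ne_zero_hasLineDerivAt_iff]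
  exact ⟨hacl.ae_lineDifferentiableAt F.continuous,
    fun U hU => hacl.volume_lineDeriv_ne_zero_pos F.continuous F.injective hU⟩

theorem unitSquare_interior_nonempty : (interior unitSquare).Nonempty := by
  rw [unitSquare, Complex.interior_reProdIm, interior_Icc]
  exact ⟨⟨1 / 2, 1 / 2⟩, by norm_num [Complex.mem_reProdIm]⟩

theorem mainTheorem11
    (H : Equiv.Perm H3) (h : RiemannSphere ≃ₜ RiemannSphere) (hHh : IsEquivariantPair H h)
    (hinfty : h OnePoint.infty = OnePoint.infty)
    (f : ℂ → ℂ) (hf : ∀ z : ℂ, h (z : RiemannSphere) = (f z : RiemannSphere)) :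
    volume {z ∈ unitSquare | ¬ ∃ c : ℂ, HasLineDerivAt ℝ f c z 1} = 0 ∧
      0 < volume {z ∈ unitSquare | ∃ c : ℂ, c ≠ 0 ∧ HasLineDerivAt ℝ f c z 1} := by
  obtain ⟨hnull, hfat⟩ := mainTheorem11_general hHh.1.continuous H.injective
    hHh.isCocompactlyEquivariant hHh.2.1 hinfty hf
  exact ⟨measure_mono_null (fun z hz => hz.2) hnull, hfat _ unitSquare_interior_nonempty⟩
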